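/- Conventions. Graphs are row-finite directed graphs $E=(E^0,E^1,r,s)$ (every vertex emits finitely many edges; loops, multiple edges and the empty graph are allowed), and $K$ is a field. A set $X\subseteq E^0$ is hereditary if $v\in X$ and the existence of a path from $v$ to $w$ imply $w\in X$; it is saturated if every regular vertex $v$ (one emitting at least one and only finitely many edges) with $r(s^{-1}(v))\subseteq X$ lies in $X$. For a hereditary set $X$, the quotient graph $E/X$ has vertex set $E^0\setminus X$ and edge set $\{e\in E^1: r(e)\notin X\}$, with the restricted maps $r,s$. The Leavitt path algebra $L_K(E)$ is the associative (not necessarily unital) $K$-algebra generated by the vertices $v\in E^0$, the edges $e\in E^1$ and the ghost edges $e^*$ ($e\in E^1$), subject to $vw=\delta_{v,w}v$, $s(e)e=e=e\,r(e)$, $r(e)e^*=e^*=e^*s(e)$, $e^*f=\delta_{e,f}r(e)$, and $v=\sum_{s(e)=v}ee^*$ for every regular vertex $v$. For $X\subseteq E^0$, $I(X)$ is the two-sided ideal of $L_K(E)$ generated by $X$. A point functor $H$ is a subfunctor of the functor $E\mapsto E^0$ from the category of graphs and graph isomorphisms to sets: it assigns to every graph $E$ a subset $H(E)\subseteq E^0$,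 compatibly with graph isomorphisms. It is hereditary and saturated if every $H(E)$ is. It is invariant if $f(I(H(E)))=I(H(F))$ for all graphs $E,F$ and every ring isomorphism $f\colon L_K(E)\to L_K(F)$. Proposition. Let $H_1,H_2$ be hereditary and saturated point functors. (1) For every graph $E$ the canonical homomorphism $\theta\colon L_K(E)/I(H_1(E))\to L_K(E/H_1(E))$, which sends the class of a vertex, edge or ghost edge of $E$ to the generator of the same name if it belongs to $E/H_1(E)$ and to $0$ otherwise, is an isomorphism. (2) For every graph $E$ there is a unique hereditary and saturated set $(H_2*H_1)(E)\subseteq E^0$ such that $I(H_1(E))\subseteq I((H_2*H_1)(E))$ and $$\theta\bigl(I((H_2*H_1)(E))/I(H_1(E))\bigr)=I\bigl(H_2(E/H_1(E))\bigr).$$ (3) The assignment $E\mapsto (H_2*H_1)(E)$ is a hereditary and saturated point functor $H_2*H_1$, and if $H_1$ and $H_2$ are both invariant, then $H_2*H_1$ is invariant. -/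

import Mathlib

open CategoryTheory

universe u w

namespace LPA

/-! ### Directed graphs -/

/-- A directed graph `(E⁰, E¹, r, s)`; loops and multiple edges are allowed. -/
structure DirectedGraph where
  /-- the set `E⁰` of vertices -/
  V : Type u
  /-- the set `E¹` of edges -/
  A : Type u
  /-- the source map -/
  s : A → V
  /-- the range map -/
  r : A → V

namespace DirectedGraph

variable (E : DirectedGraph.{u})

/-- The set `s⁻¹(v)` of edges emitted by `v`. -/
def emitted (v : E.V) : Set E.A := {e | E.s e = v}

/-- A vertex is regular if it is neither a sink nor an infinite emitter. -/
def IsRegular (v : E.V) : Prop := (E.emitted v).Nonempty ∧ (E.emitted v).Finite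

/-- `v ≥ w`: there is a path (possibly of length zero) from `v` to `w`. -/
def Connects (v w : E.V) : Prop :=
  Relation.ReflTransGen (fun a b => ∃ e : E.A, E.s e = a ∧ E.r e = b) v w

/-- Hereditary sets of vertices. -/
def IsHereditary (H : Set E.V) : Prop := ∀ v ∈ H, ∀ x : E.V, E.Connects v x → x ∈ H

/-- Saturated sets of vertices. -/
def IsSaturated (H : Set E.V) : Prop :=
  ∀ v : E.V, E.IsRegular v → (∀ e ∈ E.emitted v, E.r e ∈ H) → v ∈ H

/-- Hereditary and saturated sets of vertices. -/
structure IsHerSat (H : Set E.V) : Prop where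
  hereditary : E.IsHereditary H
  saturated : E.IsSaturated H

variable {E}

theorem IsHereditary.range_mem {H : Set E.V} (hH : E.IsHereditary H) {e : E.A}
    (he : E.s e ∈ H) : E.r e ∈ H :=
  hH _ he _ (Relation.ReflTransGen.single ⟨e, rfl, rfl⟩)

variable (E) in
/-- The quotient graph `E/H` of `E` by a hereditary set `H`: its vertices are those outside `H`,
its edges are those whose range lies outside `H`. -/
abbrev quot (H : Set E.V) (hH : E.IsHereditary H) : DirectedGraph.{u} where
  V := {v : E.V // v ∉ H}
  A := {e : E.A // E.r e ∉ H}
  s e := ⟨E.s e.1, fun h => e.2 (hH.range_mem h)⟩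
  r e := ⟨E.r e.1, e.2⟩

end DirectedGraph

/-- Row-finite directed graphs: every vertex emits only finitely many edges. -/
structure RowFiniteGraph extends DirectedGraph.{u} where
  rowFinite : ∀ v : V, (toDirectedGraph.emitted v).Finite

/-- The quotient `E/H` of a row-finite graph is row-finite. -/
abbrev RowFiniteGraph.quot (E : RowFiniteGraph.{u}) (H : Set E.V) (hH : E.IsHereditary H) :
    RowFiniteGraph.{u} where
  toDirectedGraph := E.toDirectedGraph.quot H hH
  rowFinite v := by
    refine Set.Finite.of_finite_image (f := Subtype.val)
      ((E.rowFinite v.1).subset ?_) Subtype.val_injective.injOn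
    rintro _ ⟨e, he, rfl⟩
    exact congrArg Subtype.val he

/-! ### The category of graphs and isomorphisms; point functors -/

/-- Isomorphisms of directed graphs. -/
@[ext]
structure GraphIso (E F : DirectedGraph.{u}) where
  /-- the bijection between the vertices -/
  onV : E.V ≃ F.V
  /-- the bijection between the edges -/
  onA : E.A ≃ F.A
  source_comm : ∀ e, F.s (onA e) = onV (E.s e)
  range_comm : ∀ e, F.r (onA e) = onV (E.r e)

/-- The category whose objects are the (row-finite) graphs and whose morphisms are the graph
isomorphisms. -/
instance : Category.{u} RowFiniteGraph.{u} where
  Hom E F := GraphIso E.toDirectedGraph F.toDirectedGraph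
  id E := ⟨Equiv.refl _, Equiv.refl _, fun _ => rfl, fun _ => rfl⟩
  comp α β := ⟨α.onV.trans β.onV, α.onA.trans β.onA,
    fun e => by simp [α.source_comm, β.source_comm],
    fun e => by simp [α.range_comm, β.range_comm]⟩

/-- The functor `E ↦ E⁰`. -/
def vertexFunctor : RowFiniteGraph.{u} ⥤ Type u where
  obj E := E.V
  map α := TypeCat.ofHom (GraphIso.onV α)

/-- A point functor is a subfunctor of `E ↦ E⁰`. -/
abbrev PointFunctor := Subfunctor vertexFunctor.{u}

/-- The set of vertices `H(E) ⊆ E⁰`. -/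
def PointFunctor.verts (H : PointFunctor.{u}) (E : RowFiniteGraph.{u}) : Set E.V := H.obj E

/-- Hereditary and saturated point functors. -/
def PointFunctor.IsHerSat (H : PointFunctor.{u}) : Prop :=
  ∀ E : RowFiniteGraph.{u}, E.toDirectedGraph.IsHerSat (H.verts E)

/-! ### Leavitt path algebras -/

/-- The generators of the Leavitt path algebra: vertices, edges and ghost edges. -/
inductive Gen (E : DirectedGraph.{u}) : Type u
  | vertex : E.V → Gen E
  | edge : E.A → Gen E
  | ghost : E.A → Gen E

variable (K : Type w) [Field K]

/-- The free associative, not necessarily unital, `K`-algebra on the generators. -/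
abbrev FreeAlg (E : DirectedGraph.{u}) : Type (max w u) := MonoidAlgebra K (FreeSemigroup (Gen E))

/-- A generator as an element of the free algebra. -/
noncomputable def FreeAlg.of {E : DirectedGraph.{u}} (x : Gen E) : FreeAlg K E :=
  MonoidAlgebra.single (FreeSemigroup.of x) 1

open FreeAlg Gen in
/-- The defining relations of the Leavitt path algebra, together with all their scalar
multiples. -/
inductive Rel (E : DirectedGraph.{u}) : FreeAlg K E → FreeAlg K E → Prop
  | vertex_mul_self (v : E.V) : Rel E (of K (vertex v) * of K (vertex v)) (of K (vertex v))
  | vertex_mul_ne (v x : E.V) (h : v ≠ x) : Rel E (of K (vertex v) * of K (vertex x)) 0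
  | source_mul_edge (e : E.A) : Rel E (of K (vertex (E.s e)) * of K (edge e)) (of K (edge e))
  | edge_mul_range (e : E.A) : Rel E (of K (edge e) * of K (vertex (E.r e))) (of K (edge e))
  | range_mul_ghost (e : E.A) : Rel E (of K (vertex (E.r e)) * of K (ghost e)) (of K (ghost e))
  | ghost_mul_source (e : E.A) : Rel E (of K (ghost e) * of K (vertex (E.s e))) (of K (ghost e))
  | ck1_self (e : E.A) : Rel E (of K (ghost e) * of K (edge e)) (of K (vertex (E.r e)))
  | ck1_ne (e f : E.A) (h : e ≠ f) : Rel E (of K (ghost e) * of K (edge f)) 0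
  | ck2 (v : E.V) (h : E.IsRegular v) :
      Rel E (of K (vertex v)) (∑ e ∈ h.2.toFinset, of K (edge e) * of K (ghost e))
  | smul (k : K) (a b : FreeAlg K E) (h : Rel E a b) : Rel E (k • a) (k • b)

/-- The congruence on the free algebra generated by the defining relations. -/
noncomputable def con (E : DirectedGraph.{u}) : RingCon (FreeAlg K E) := ringConGen (Rel K E)

/-- The Leavitt path algebra `L_K(E)`. -/
def Leavitt (E : DirectedGraph.{u}) : Type (max w u) := (con K E).Quotient

namespace Leavitt

variable (E : DirectedGraph.{u})

noncomputable instance : NonUnitalRing (Leavitt K E) :=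
  inferInstanceAs (NonUnitalRing (con K E).Quotient)

theorem con_smul (k : K) {a b : FreeAlg K E} (h : con K E a b) :
    con K E (k • a) (k • b) := by
  have h' : RingConGen.Rel (Rel K E) a b := h
  change RingConGen.Rel (Rel K E) (k • a) (k • b)
  clear h
  induction h' with
  | of x y h => exact .of _ _ (.smul k _ _ h)
  | refl x => exact .refl _
  | symm _ ih => exact ih.symm
  | trans _ _ ih₁ ih₂ => exact ih₁.trans ih₂
  | add _ _ ih₁ ih₂ => simpa only [smul_add] using ih₁.add ih₂
  | mul h₁ h₂ ih₁ ih₂ => simpa only [smul_mul_assoc] using ih₁.mul h₂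

/-- The quotient map from the free algebra. -/
noncomputable def mk (a : FreeAlg K E) : Leavitt K E := RingCon.toQuotient (c := con K E) a

noncomputable instance : SMul K (Leavitt K E) :=
  ⟨fun k => Quotient.map' (s₁ := (con K E).toSetoid) (s₂ := (con K E).toSetoid)
    (fun a => k • a) (fun _ _ h => con_smul K E k h)⟩

variable {E}

theorem mk_surjective : Function.Surjective (mk K E) := Quotient.mk''_surjective

theorem mk_eq {a b : FreeAlg K E} : mk K E a = mk K E b ↔ con K E a b := RingCon.eq _

theorem mk_add (a b : FreeAlg K E) : mk K E (a + b) = mk K E a + mk K E b := rfl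

theorem mk_mul (a b : FreeAlg K E) : mk K E (a * b) = mk K E a * mk K E b := rfl

theorem mk_zero : mk K E 0 = 0 := rfl

theorem mk_smul (k : K) (a : FreeAlg K E) : mk K E (k • a) = k • mk K E a := rfl

noncomputable instance : Module K (Leavitt K E) where
  one_smul := (mk_surjective K).forall.2 fun a => by rw [← mk_smul, one_smul]
  mul_smul k l := (mk_surjective K).forall.2 fun a => by simp only [← mk_smul, mul_smul]
  smul_zero k := by rw [← mk_zero, ← mk_smul, smul_zero]
  smul_add k := (mk_surjective K).forall₂.2 fun a b => by
    simp only [← mk_smul, ← mk_add, smul_add]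
  add_smul k l := (mk_surjective K).forall.2 fun a => by
    simp only [← mk_smul, ← mk_add, add_smul]
  zero_smul := (mk_surjective K).forall.2 fun a => by rw [← mk_smul, zero_smul, mk_zero]

instance : IsScalarTower K (Leavitt K E) (Leavitt K E) :=
  ⟨fun k => (mk_surjective K).forall₂.2 fun a b => by
    simp only [smul_eq_mul, ← mk_smul, ← mk_mul, smul_mul_assoc]⟩

instance : SMulCommClass K (Leavitt K E) (Leavitt K E) :=
  ⟨fun k => (mk_surjective K).forall₂.2 fun a b => by
    simp only [smul_eq_mul, ← mk_smul, ← mk_mul, mul_smul_comm]⟩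

/-- A vertex as an element of `L_K(E)`. -/
noncomputable def vertex (v : E.V) : Leavitt K E := mk K E (FreeAlg.of K (.vertex v))

/-- An edge as an element of `L_K(E)`. -/
noncomputable def edge (e : E.A) : Leavitt K E := mk K E (FreeAlg.of K (.edge e))

/-- A ghost edge as an element of `L_K(E)`. -/
noncomputable def ghost (e : E.A) : Leavitt K E := mk K E (FreeAlg.of K (.ghost e))

/-- The ideal `I(H)` of `L_K(E)` generated by a set `H` of vertices. -/
noncomputable def ideal (H : Set E.V) : TwoSidedIdeal (Leavitt K E) :=
  TwoSidedIdeal.span (vertex K '' H)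

section lift

variable {B : Type*} [NonUnitalRing B] [Module K B]

/-- The homomorphism from the free algebra given by the images of the generators. -/
noncomputable def freeLift [IsScalarTower K B B] [SMulCommClass K B B] (φ : Gen E → B) : FreeAlg K E →ₙₐ[K] B :=
  MonoidAlgebra.liftMagma K (FreeSemigroup.lift φ)

theorem freeLift_of [IsScalarTower K B B] [SMulCommClass K B B] (φ : Gen E → B) (x : Gen E) : freeLift K φ (FreeAlg.of K x) = φ x := by
  simp [freeLift, FreeAlg.of]

theorem con_le_of_rel (g : FreeAlg K E →ₙₐ[K] B)
    (hg : ∀ a b, Rel K E a b → g a = g b) {a b : FreeAlg K E} (h : con K E a b) : g a = g b := by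
  have h' : RingConGen.Rel (Rel K E) a b := h
  clear h
  induction h' with
  | of x y h => exact hg _ _ h
  | refl x => rfl
  | symm _ ih => exact ih.symm
  | trans _ _ ih₁ ih₂ => exact ih₁.trans ih₂
  | add _ _ ih₁ ih₂ => rw [map_add, map_add, ih₁, ih₂]
  | mul _ _ ih₁ ih₂ => rw [map_mul, map_mul, ih₁, ih₂]

/-- The homomorphism of `K`-algebras out of `L_K(E)` induced by one out of the free algebra that
respects the defining relations. -/
noncomputable def lift (g : FreeAlg K E →ₙₐ[K] B) (hg : ∀ a b, Rel K E a b → g a = g b) :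
    Leavitt K E →ₙₐ[K] B where
  toFun := Quotient.lift (s := (con K E).toSetoid) g fun _ _ h => con_le_of_rel K g hg h
  map_smul' k := (mk_surjective K).forall.2 fun a => map_smul g k a
  map_zero' := map_zero g
  map_add' := (mk_surjective K).forall₂.2 fun a b => map_add g a b
  map_mul' := (mk_surjective K).forall₂.2 fun a b => map_mul g a b

theorem lift_mk (g : FreeAlg K E →ₙₐ[K] B) (hg : ∀ a b, Rel K E a b → g a = g b)
    (a : FreeAlg K E) : lift K g hg (mk K E a) = g a := rfl

end lift

/-! ### The canonical map `L_K(E)/I(H) → L_K(E/H)` -/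

open Classical in
/-- The images of the generators under `L_K(E) → L_K(E/H)`: a generator goes to the generator of
the same name if it belongs to `E/H`, and to zero otherwise. -/
noncomputable def quotGen (H : Set E.V) (hH : E.IsHereditary H) :
    Gen E → Leavitt K (E.quot H hH)
  | .vertex v => if h : v ∉ H then vertex K (E := E.quot H hH) ⟨v, h⟩ else 0
  | .edge e => if h : E.r e ∉ H then edge K (E := E.quot H hH) ⟨e, h⟩ else 0
  | .ghost e => if h : E.r e ∉ H then ghost K (E := E.quot H hH) ⟨e, h⟩ else 0

theorem of_rel {a b : FreeAlg K E} (h : Rel K E a b) : mk K E a = mk K E b :=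
  (mk_eq K).2 (RingConGen.Rel.of _ _ h)

theorem quotGen_rel (H : Set E.V) (hH : E.IsHerSat H) {a b : FreeAlg K E} (h : Rel K E a b) :
    freeLift K (quotGen K H hH.hereditary) a = freeLift K (quotGen K H hH.hereditary) b := by
  classical
  have hr : ∀ {e : E.A}, E.r e ∉ H → E.s e ∉ H := fun he h => he (hH.hereditary.range_mem h)
  induction h with
  | vertex_mul_self v =>
    simp only [map_mul, freeLift_of, quotGen]
    by_cases h : v ∉ H
    · rw [dif_pos h]
      exact of_rel K (.vertex_mul_self (E := E.quot H hH.hereditary) ⟨v, h⟩)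
    · rw [dif_neg h, mul_zero]
  | vertex_mul_ne v x hvx =>
    simp only [map_mul, map_zero, freeLift_of, quotGen]
    by_cases h : v ∉ H
    · by_cases h' : x ∉ H
      · rw [dif_pos h, dif_pos h']
        exact of_rel K (.vertex_mul_ne (E := E.quot H hH.hereditary) ⟨v, h⟩ ⟨x, h'⟩
          fun h => hvx (congrArg Subtype.val h))
      · rw [dif_neg h', mul_zero]
    · rw [dif_neg h, zero_mul]
  | source_mul_edge e =>
    simp only [map_mul, freeLift_of, quotGen]
    by_cases h : E.r e ∉ H
    · rw [dif_pos h, dif_pos (hr h)]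
      exact of_rel K (.source_mul_edge (E := E.quot H hH.hereditary) ⟨e, h⟩)
    · rw [dif_neg h, mul_zero]
  | edge_mul_range e =>
    simp only [map_mul, freeLift_of, quotGen]
    by_cases h : E.r e ∉ H
    · rw [dif_pos h, dif_pos h]
      exact of_rel K (.edge_mul_range (E := E.quot H hH.hereditary) ⟨e, h⟩)
    · rw [dif_neg h, zero_mul]
  | range_mul_ghost e =>
    simp only [map_mul, freeLift_of, quotGen]
    by_cases h : E.r e ∉ H
    · rw [dif_pos h, dif_pos h]
      exact of_rel K (.range_mul_ghost (E := E.quot H hH.hereditary) ⟨e, h⟩)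
    · rw [dif_neg h, dif_neg h, mul_zero]
  | ghost_mul_source e =>
    simp only [map_mul, freeLift_of, quotGen]
    by_cases h : E.r e ∉ H
    · rw [dif_pos h, dif_pos (hr h)]
      exact of_rel K (.ghost_mul_source (E := E.quot H hH.hereditary) ⟨e, h⟩)
    · rw [dif_neg h, zero_mul]
  | ck1_self e =>
    simp only [map_mul, freeLift_of, quotGen]
    by_cases h : E.r e ∉ H
    · rw [dif_pos h, dif_pos h, dif_pos h]
      exact of_rel K (.ck1_self (E := E.quot H hH.hereditary) ⟨e, h⟩)
    · rw [dif_neg h, dif_neg h, dif_neg h, zero_mul]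
  | ck1_ne e f hef =>
    simp only [map_mul, map_zero, freeLift_of, quotGen]
    by_cases h : E.r e ∉ H
    · by_cases h' : E.r f ∉ H
      · rw [dif_pos h, dif_pos h']
        exact of_rel K (.ck1_ne (E := E.quot H hH.hereditary) ⟨e, h⟩ ⟨f, h'⟩
          fun h => hef (congrArg Subtype.val h))
      · rw [dif_neg h', mul_zero]
    · rw [dif_neg h, zero_mul]
  | ck2 v hv =>
    simp only [map_sum, map_mul, freeLift_of, quotGen]
    by_cases h : v ∉ H
    · rw [dif_pos h]
      obtain ⟨e, he, her⟩ : ∃ e ∈ E.emitted v, E.r e ∉ H := by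
        by_contra! hcon
        exact h (hH.saturated v hv hcon)
      have hreg : (E.quot H hH.hereditary).IsRegular ⟨v, h⟩ := by
        refine ⟨⟨⟨e, her⟩, Subtype.ext he⟩, Set.Finite.of_finite_image (f := Subtype.val)
          (hv.2.subset ?_) Subtype.val_injective.injOn⟩
        rintro _ ⟨f, hf, rfl⟩
        exact congrArg Subtype.val hf
      refine (of_rel K (.ck2 (E := E.quot H hH.hereditary) ⟨v, h⟩ hreg)).trans ?_
      refine (map_sum (⟨⟨mk K _, rfl⟩, mk_add K⟩ : FreeAlg K (E.quot H hH.hereditary) →+ _) _ _).trans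
        ?_
      refine Finset.sum_of_injOn Subtype.val Subtype.val_injective.injOn ?_ ?_ ?_
      · intro f hf
        have hf' : f ∈ (E.quot H hH.hereditary).emitted ⟨v, h⟩ := hreg.2.mem_toFinset.1 hf
        exact hv.2.mem_toFinset.2 (congrArg Subtype.val hf' : E.s f.1 = v)
      · intro f hf hf'
        rw [dif_neg, zero_mul]
        intro hfr
        refine hf' ⟨⟨f, hfr⟩, ?_, rfl⟩
        have hf2 : f ∈ E.emitted v := hv.2.mem_toFinset.1 hf
        have : (⟨f, hfr⟩ : (E.quot H hH.hereditary).A) ∈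
            (E.quot H hH.hereditary).emitted ⟨v, h⟩ := Subtype.ext hf2
        exact hreg.2.mem_toFinset.2 this
      · intro f _
        rw [dif_pos f.2, dif_pos f.2]
        rfl
    · rw [dif_neg h]
      refine (Finset.sum_eq_zero fun e he => ?_).symm
      have he' : E.s e = v := hv.2.mem_toFinset.1 he
      rw [dif_neg, zero_mul]
      exact fun hn => hr hn (he' ▸ not_not.1 h)
  | smul k a b _ ih => rw [map_smul, map_smul, ih]

/-- The canonical homomorphism `L_K(E) → L_K(E/H)`. -/
noncomputable def quotHom (H : Set E.V) (hH : E.IsHerSat H) :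
    Leavitt K E →ₙₐ[K] Leavitt K (E.quot H hH.hereditary) :=
  lift K (freeLift K (quotGen K H hH.hereditary)) fun _ _ => quotGen_rel K H hH

theorem ideal_le_ker (H : Set E.V) (hH : E.IsHerSat H) :
    ideal K H ≤ TwoSidedIdeal.ker (quotHom K H hH) := by
  refine TwoSidedIdeal.span_le.2 ?_
  rintro _ ⟨v, hv, rfl⟩
  refine (TwoSidedIdeal.mem_ker _).2 ?_
  refine (lift_mk K _ _ _).trans ((freeLift_of K _ _).trans ?_)
  exact dif_neg (not_not.2 hv)

/-- The quotient ring `L_K(E)/I` by a two-sided ideal. -/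
abbrev QuotRing (I : TwoSidedIdeal (Leavitt K E)) : Type (max w u) := I.ringCon.Quotient

/-- The canonical map `θ : L_K(E)/I(H) → L_K(E/H)`, `x + I(H) ↦ x`. -/
noncomputable def theta (H : Set E.V) (hH : E.IsHerSat H) :
    QuotRing K (ideal K H) →ₙ+* Leavitt K (E.quot H hH.hereditary) where
  toFun := Quotient.lift (s := (ideal K H).ringCon.toSetoid) (quotHom K H hH) fun a b hab =>
    sub_eq_zero.1 <| (map_sub (quotHom K H hH) a b).symm.trans <| (TwoSidedIdeal.mem_ker _).1 <|
      ideal_le_ker K H hH (((ideal K H).rel_iff a b).1 hab)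
  map_zero' := map_zero (quotHom K H hH)
  map_add' := Quotient.mk''_surjective.forall₂.2 fun a b => map_add (quotHom K H hH) a b
  map_mul' := Quotient.mk''_surjective.forall₂.2 fun a b => map_mul (quotHom K H hH) a b

/-- The image `I/J` of an ideal `I ⊇ J` of `L_K(E)` in the quotient ring `L_K(E)/J`. -/
def imageInQuot (J I : TwoSidedIdeal (Leavitt K E)) : Set (QuotRing K J) :=
  (fun x : Leavitt K E => (x : QuotRing K J)) '' {x | x ∈ I}

end Leavitt

/-! ### Invariance and the operation `H₂ * H₁` -/

/-- A point functor `H` is invariant under isomorphism if `f(I(H(E))) = I(H(F))` for every ring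
isomorphism `f : L_K(E) → L_K(F)`. -/
def PointFunctor.IsInvariant (H : PointFunctor.{u}) : Prop :=
  ∀ (E F : RowFiniteGraph.{u})
    (f : Leavitt K E.toDirectedGraph ≃+* Leavitt K F.toDirectedGraph),
    f '' {x | x ∈ Leavitt.ideal K (H.verts E)} = {y | y ∈ Leavitt.ideal K (H.verts F)}

/-- `X` is a hereditary and saturated subset of `E⁰` such that `I(X)` contains `I(H₁(E))` and
`θ : L_K(E)/I(H₁(E)) → L_K(E/H₁(E))` maps `I(X)/I(H₁(E))` onto `I(H₂(E/H₁(E)))`. -/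
structure IsMixedSet (H₂ H₁ : PointFunctor.{u}) (h₁ : H₁.IsHerSat) (E : RowFiniteGraph.{u})
    (X : Set E.V) : Prop where
  isHerSat : E.toDirectedGraph.IsHerSat X
  le : Leavitt.ideal K (H₁.verts E) ≤ Leavitt.ideal K X
  theta_image :
    Leavitt.theta K (H₁.verts E) (h₁ E) ''
        Leavitt.imageInQuot K (Leavitt.ideal K (H₁.verts E)) (Leavitt.ideal K X) =
      {y | y ∈ Leavitt.ideal K (H₂.verts (E.quot (H₁.verts E) (h₁ E).hereditary))}

/-- `H` is the point functor `H₂ * H₁`: for every graph `E`, the set `H(E)` is the hereditary and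
saturated subset of `E⁰` with `I(H(E))/I(H₁(E)) ≅ I(H₂(E/H₁(E)))` via `θ`. -/
def PointFunctor.IsMixed (H₂ H₁ : PointFunctor.{u}) (h₁ : H₁.IsHerSat) (H : PointFunctor.{u}) :
    Prop :=
  ∀ E : RowFiniteGraph.{u}, IsMixedSet K H₂ H₁ h₁ E (H.verts E)

end LPA

/-!
# The operation `H₂ * H₁` on hereditary and saturated point functors

*The isomorphism `θ`.* The map `L_K(E) → L_K(E/H)` has a section modulo `I(H)`: sending each generator of
`L_K(E/H)` to the generator of `L_K(E)` of the same name respects the defining relations up to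
elements of `I(H)` (`Leavitt.sectionGen_rel`), and every element of `L_K(E)` is congruent modulo
`I(H)` to one in the image of this section (`Leavitt.exists_section`). Hence the map is surjective
with kernel `I(H)` (`Leavitt.quotHom_eq_zero_iff`).

*Existence.* The set `(H₂ * H₁)(E)` is `H₁(E)` together with the vertices of `E/H₁(E)` that lie in
`H₂(E/H₁(E))`. The ideal it generates is the preimage of `I(H₂(E/H₁(E)))` under
`L_K(E) → L_K(E/H₁(E))` (`Leavitt.mem_ideal_extend_iff`).

*Uniqueness.* The condition on `θ` determines the ideal `I(X)`, and a hereditary and saturated set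
`X` is recovered from `I(X)` as the set of vertices that it contains
(`Leavitt.vertex_mem_ideal_iff`). This uses that vertices are nonzero in a Leavitt path algebra, here
`L_K(E/X)`. To see it, `L_K(E)` is made to act on functions `E⁰ × ℕ → K`: a vertex `v` acts as the
restriction to `{v} × ℕ`, and edges act by identifying `{v} × ℕ`, for `v` not a sink, with the
disjoint union of the sets `{r(e)} × ℕ` over the edges `e` emitted by `v`
(`Leavitt.vertex_ne_zero`).

*Invariance.* A ring isomorphism `L_K(E) → L_K(F)` that preserves the ideals `I(H₁)` descends to the
algebras of the quotient graphs, where it preserves the ideals `I(H₂)`; pulling back, it preserves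
the ideals `I(H₂ * H₁)` (`PointFunctor.mixed_isInvariant`).
-/

namespace LPA

open Function

/-! ### Vertices are nonzero in the Leavitt path algebra -/

namespace DirectedGraph

variable {E : DirectedGraph.{u}}

/-- Attach a copy of `ℕ` to every vertex. The copies at the ranges of the edges emitted by `v`
can be packed disjointly into the copy at `v`, filling it completely unless `v` is a sink. -/
theorem exists_packing (hE : ∀ v, (E.emitted v).Countable) :
    ∃ σ : E.A × ℕ → E.V × ℕ, Function.Injective σ ∧ (∀ p, (σ p).1 = E.s p.1) ∧
      ∀ z : E.V × ℕ, (E.emitted z.1).Nonempty → z ∈ Set.range σ := by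
  have key : ∀ v, ∃ τ : E.emitted v × ℕ → ℕ,
      Function.Injective τ ∧ ((E.emitted v).Nonempty → Surjective τ) := by
    intro v
    have := (hE v).to_subtype
    by_cases hne : (E.emitted v).Nonempty
    · have := hne.to_subtype
      obtain ⟨d⟩ := nonempty_denumerable (E.emitted v × ℕ)
      exact ⟨Denumerable.eqv _, Equiv.injective _, fun _ => Equiv.surjective _⟩
    · exact ⟨fun _ => 0, fun a => (hne ⟨a.1.1, a.1.2⟩).elim, fun h => (hne h).elim⟩
  choose τ hinj hsurj using key
  refine ⟨fun p => (E.s p.1, τ (E.s p.1) (⟨p.1, rfl⟩, p.2)), ?_, fun _ => rfl, ?_⟩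
  · rintro ⟨e, n⟩ ⟨f, m⟩ h
    have hs : E.s e = E.s f := congrArg Prod.fst h
    have aux : ∀ (v : E.V) (he : E.s e = v),
        τ (E.s e) (⟨e, rfl⟩, n) = τ v (⟨e, he⟩, n) := by
      rintro _ rfl
      rfl
    have h' := hinj _ ((aux _ hs).symm.trans (congrArg Prod.snd h))
    obtain ⟨h₁, h₂⟩ := Prod.mk.inj h'
    exact Prod.ext (congrArg Subtype.val h₁) h₂
  · rintro ⟨v, n⟩ hv
    obtain ⟨⟨⟨e, rfl⟩, m⟩, hm⟩ := hsurj v hv n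
    exact ⟨(e, m), Prod.ext rfl hm⟩

end DirectedGraph

namespace Leavitt

variable (K : Type w) [Field K] {E : DirectedGraph.{u}}

/-- The operator on functions `Z → K` that substitutes a partial self-map of `Z` into the argument,
with value `0` where the map is undefined. -/
def substOp {Z : Type*} (p : Z → Option Z) : Module.End K (Z → K) where
  toFun f z := (p z).elim 0 f
  map_add' f g := by
    ext z
    simp only [Pi.add_apply]
    cases p z <;> simp
  map_smul' k f := by
    ext z
    simp only [Pi.smul_apply, RingHom.id_apply]
    cases p z <;> simp

open Classical in
/-- The partial self-maps of `E⁰ × ℕ` by which the generators act, for a packing `σ` as in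
`DirectedGraph.exists_packing`. -/
noncomputable def packingGen (σ : E.A × ℕ → E.V × ℕ) :
    Gen E → E.V × ℕ → Option (E.V × ℕ)
  | .vertex v => fun z => if z.1 = v then some z else none
  | .edge e => fun z => (partialInv σ z).bind fun p =>
      if p.1 = e then some (E.r e, p.2) else none
  | .ghost e => fun z => if z.1 = E.r e then some (σ (e, z.2)) else none

/-- The action of the free algebra on functions `E⁰ × ℕ → K` respects the defining relations. -/
theorem packing_rel {σ : E.A × ℕ → E.V × ℕ} (hinj : Function.Injective σ)
    (hs : ∀ p, (σ p).1 = E.s p.1)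
    (hσ : ∀ z : E.V × ℕ, (E.emitted z.1).Nonempty → z ∈ Set.range σ)
    {a b : FreeAlg K E} (h : Rel K E a b) :
    freeLift K (fun x => substOp K (packingGen σ x)) a =
      freeLift K (fun x => substOp K (packingGen σ x)) b := by
  classical
  have hout : ∀ z, z ∉ Set.range σ → partialInv σ z = none := fun z hz => dif_neg hz
  have hV : ∀ v f z, substOp K (packingGen σ (.vertex v)) f z = if z.1 = v then f z else 0 := by
    intro v f z
    simp only [substOp, packingGen, LinearMap.coe_mk, AddHom.coe_mk]
    split_ifs <;> rfl
  have hG : ∀ e f z, substOp K (packingGen σ (.ghost e)) f z =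
      if z.1 = E.r e then f (σ (e, z.2)) else 0 := by
    intro e f z
    simp only [substOp, packingGen, LinearMap.coe_mk, AddHom.coe_mk]
    split_ifs <;> rfl
  have hA : ∀ e f p, substOp K (packingGen σ (.edge e)) f (σ p) =
      if p.1 = e then f (E.r e, p.2) else 0 := by
    intro e f p
    simp only [substOp, packingGen, LinearMap.coe_mk, AddHom.coe_mk, partialInv_left hinj,
      Option.bind_some]
    split_ifs <;> rfl
  have hA' : ∀ e f z, z ∉ Set.range σ → substOp K (packingGen σ (.edge e)) f z = 0 := by
    intro e f z hz
    simp [substOp, packingGen, hout z hz]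
  induction h with
  | vertex_mul_self v =>
    ext1 f; ext1 z
    simp only [map_mul, freeLift_of, Module.End.mul_apply, hV]
    split_ifs <;> rfl
  | vertex_mul_ne v x hvx =>
    ext1 f; ext1 z
    simp only [map_mul, map_zero, freeLift_of, Module.End.mul_apply, hV]
    split_ifs with h h'
    · exact absurd (h.symm.trans h') hvx
    · rfl
    · rfl
  | source_mul_edge e =>
    ext1 f; ext1 z
    simp only [map_mul, freeLift_of, Module.End.mul_apply, hV]
    by_cases hz : z ∈ Set.range σ
    · obtain ⟨p, rfl⟩ := hz
      rw [hA, hs]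
      by_cases hp : p.1 = e
      · rw [if_pos (congrArg E.s hp)]
      · rw [if_neg hp, ite_self]
    · rw [hA' _ _ _ hz, ite_self]
  | edge_mul_range e =>
    ext1 f; ext1 z
    simp only [map_mul, freeLift_of, Module.End.mul_apply]
    by_cases hz : z ∈ Set.range σ
    · obtain ⟨p, rfl⟩ := hz
      simp [hA, hV]
    · rw [hA' _ _ _ hz, hA' _ _ _ hz]
  | range_mul_ghost e =>
    ext1 f; ext1 z
    simp only [map_mul, freeLift_of, Module.End.mul_apply, hV, hG]
    split_ifs <;> rfl
  | ghost_mul_source e =>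
    ext1 f; ext1 z
    simp only [map_mul, freeLift_of, Module.End.mul_apply, hV, hG, hs, if_true]
  | ck1_self e =>
    ext1 f; ext1 z
    simp only [map_mul, freeLift_of, Module.End.mul_apply, hV, hG, hA, if_true]
    split_ifs with h
    · rw [← h]
    · rfl
  | ck1_ne e g hne =>
    ext1 f; ext1 z
    simp [map_mul, freeLift_of, Module.End.mul_apply, hG, hA, hne]
  | ck2 v hv =>
    ext1 f; ext1 z
    simp only [map_sum, map_mul, freeLift_of, LinearMap.sum_apply, Finset.sum_apply,
      Module.End.mul_apply, hV]
    by_cases hz : z ∈ Set.range σ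
    · obtain ⟨⟨g, n⟩, rfl⟩ := hz
      have : ∀ e ∈ hv.2.toFinset, substOp K (packingGen σ (.edge e))
          (substOp K (packingGen σ (.ghost e)) f) (σ (g, n)) =
            if g = e then f (σ (g, n)) else 0 := by
        intro e _
        rw [hA, hG, if_pos rfl]
        by_cases h : g = e
        · simp [h]
        · simp [h]
      rw [Finset.sum_congr rfl this, Finset.sum_ite_eq, hs]
      refine if_congr ?_ rfl rfl
      rw [Set.Finite.mem_toFinset]
      rfl
    · rw [Finset.sum_eq_zero fun e _ => hA' e _ z hz, if_neg]
      exact fun h => hz (hσ z (h ▸ hv.1))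
  | smul k a b _ ih => rw [map_smul, map_smul, ih]

theorem vertex_ne_zero (hE : ∀ v, (E.emitted v).Countable) (v : E.V) : vertex K v ≠ 0 := by
  obtain ⟨σ, hinj, hs, hσ⟩ := E.exists_packing hE
  intro h0
  have h := congrArg (lift K (freeLift K fun x => substOp K (packingGen σ x))
    fun _ _ => packing_rel K hinj hs hσ) h0
  rw [map_zero, vertex, lift_mk, freeLift_of] at h
  have h1 := congrFun (LinearMap.congr_fun h fun _ => 1) (v, 0)
  simp [substOp, packingGen] at h1

end Leavitt

/-! ### Ideals generated by vertices and the kernel of `L_K(E) → L_K(E/H)` -/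

namespace Leavitt

variable (K : Type w) [Field K]

variable {K} in
/-- A property of elements of `L_K(E)` holds everywhere if it holds on the generators and is stable
under the operations. -/
@[elab_as_elim]
theorem induction_on {E : DirectedGraph.{u}} {p : Leavitt K E → Prop} (x : Leavitt K E)
    (of : ∀ y : Gen E, p (mk K E (FreeAlg.of K y))) (zero : p 0)
    (add : ∀ x y, p x → p y → p (x + y)) (mul : ∀ x y, p x → p y → p (x * y))
    (smul : ∀ (k : K) x, p x → p (k • x)) : p x := by
  obtain ⟨a, rfl⟩ := mk_surjective K x
  induction a using MonoidAlgebra.induction_linear with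
  | zero => exact zero
  | add a b ha hb => exact add _ _ ha hb
  | single m k =>
    have key : ∀ m : FreeSemigroup (Gen E), p (mk K E (MonoidAlgebra.single m 1)) := by
      intro m
      induction m using FreeSemigroup.recOnMul with
      | ih1 y => exact of y
      | ih2 y m hy hm =>
        have := mul _ _ hy hm
        rwa [← mk_mul, MonoidAlgebra.single_mul_single, one_mul] at this
    have := smul k _ (key m)
    rwa [← mk_smul, MonoidAlgebra.smul_single, smul_eq_mul, mul_one] at this

variable {E : DirectedGraph.{u}}

theorem vertex_mul_self (v : E.V) : vertex K v * vertex K v = vertex K v :=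
  of_rel K (.vertex_mul_self v)

theorem edge_mul_range (e : E.A) : edge K e * vertex K (E.r e) = edge K e :=
  of_rel K (.edge_mul_range e)

theorem range_mul_ghost (e : E.A) : vertex K (E.r e) * ghost K e = ghost K e :=
  of_rel K (.range_mul_ghost e)

theorem vertex_eq_sum (v : E.V) (h : E.IsRegular v) :
    vertex K v = ∑ e ∈ h.2.toFinset, edge K e * ghost K e :=
  (of_rel K (.ck2 v h)).trans
    (map_sum (⟨⟨mk K _, rfl⟩, mk_add K⟩ : FreeAlg K E →+ Leavitt K E) _ _)

theorem vertex_mem_ideal {H : Set E.V} {v : E.V} (hv : v ∈ H) : vertex K v ∈ ideal K H :=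
  TwoSidedIdeal.subset_span ⟨v, hv, rfl⟩

theorem edge_mem_ideal {H : Set E.V} {e : E.A} (he : E.r e ∈ H) : edge K e ∈ ideal K H := by
  rw [← edge_mul_range]
  exact TwoSidedIdeal.mul_mem_left _ _ _ (vertex_mem_ideal K he)

theorem ghost_mem_ideal {H : Set E.V} {e : E.A} (he : E.r e ∈ H) : ghost K e ∈ ideal K H := by
  rw [← range_mul_ghost]
  exact TwoSidedIdeal.mul_mem_right _ _ _ (vertex_mem_ideal K he)

/-- Although `I(H)` is only defined as an ideal of the ring `L_K(E)`, it is stable under scalars,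
because `k • v = (k • v) * v`. -/
theorem smul_mem_ideal {H : Set E.V} (k : K) {x : Leavitt K E} (hx : x ∈ ideal K H) :
    k • x ∈ ideal K H := by
  have hx' : x ∈ TwoSidedIdeal.span (vertex K '' H) := hx
  clear hx
  induction hx' using TwoSidedIdeal.span_induction with
  | mem x h =>
    obtain ⟨v, hv, rfl⟩ := h
    rw [← vertex_mul_self, ← smul_mul_assoc]
    exact TwoSidedIdeal.mul_mem_left _ _ _ (vertex_mem_ideal K hv)
  | zero =>
    rw [smul_zero]
    exact TwoSidedIdeal.zero_mem _
  | add x y _ _ ihx ihy =>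
    rw [smul_add]
    exact TwoSidedIdeal.add_mem _ ihx ihy
  | neg x _ ih =>
    rw [smul_neg]
    exact TwoSidedIdeal.neg_mem _ ih
  | left_absorb a x _ ih =>
    rw [← mul_smul_comm]
    exact TwoSidedIdeal.mul_mem_left _ _ _ ih
  | right_absorb a x _ ih =>
    rw [← smul_mul_assoc]
    exact TwoSidedIdeal.mul_mem_right _ _ _ ih

theorem quotHom_mk_of (H : Set E.V) (hH : E.IsHerSat H) (x : Gen E) :
    quotHom K H hH (mk K E (FreeAlg.of K x)) = quotGen K H hH.hereditary x :=
  freeLift_of K _ _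

theorem quotHom_vertex_of_notMem {H : Set E.V} (hH : E.IsHerSat H) {v : E.V} (hv : v ∉ H) :
    quotHom K H hH (vertex K v) = vertex K (E := E.quot H hH.hereditary) ⟨v, hv⟩ :=
  (quotHom_mk_of K H hH _).trans (dif_pos hv)

/-- The generators of `L_K(E/H)`, as elements of `L_K(E)`. -/
noncomputable def sectionGen (H : Set E.V) (hH : E.IsHereditary H) :
    Gen (E.quot H hH) → Leavitt K E
  | .vertex v => vertex K v.1
  | .edge e => edge K e.1
  | .ghost e => ghost K e.1

/-- Modulo `I(H)`, the generators of `L_K(E/H)` satisfy the defining relations in `L_K(E)`. For the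
relation at a regular vertex `v`, the missing summands `e e*` have `r(e) ∈ H`. -/
theorem sectionGen_rel (hE : ∀ v, (E.emitted v).Finite) (H : Set E.V) (hH : E.IsHereditary H)
    {a b : FreeAlg K (E.quot H hH)} (h : Rel K (E.quot H hH) a b) :
    freeLift K (sectionGen K H hH) a - freeLift K (sectionGen K H hH) b ∈ ideal K H := by
  classical
  have hz : ∀ {x y : Leavitt K E}, x = y → x - y ∈ ideal K H := fun h =>
    (sub_eq_zero.2 h).symm ▸ TwoSidedIdeal.zero_mem _
  induction h with
  | vertex_mul_self v =>
    simp only [map_mul, freeLift_of, sectionGen]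
    exact hz (of_rel K (.vertex_mul_self v.1))
  | vertex_mul_ne v x h =>
    simp only [map_mul, map_zero, freeLift_of, sectionGen]
    exact hz (of_rel K (.vertex_mul_ne v.1 x.1 fun h' => h (Subtype.ext h')))
  | source_mul_edge e =>
    simp only [map_mul, freeLift_of, sectionGen]
    exact hz (of_rel K (.source_mul_edge e.1))
  | edge_mul_range e =>
    simp only [map_mul, freeLift_of, sectionGen]
    exact hz (of_rel K (.edge_mul_range e.1))
  | range_mul_ghost e =>
    simp only [map_mul, freeLift_of, sectionGen]
    exact hz (of_rel K (.range_mul_ghost e.1))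
  | ghost_mul_source e =>
    simp only [map_mul, freeLift_of, sectionGen]
    exact hz (of_rel K (.ghost_mul_source e.1))
  | ck1_self e =>
    simp only [map_mul, freeLift_of, sectionGen]
    exact hz (of_rel K (.ck1_self e.1))
  | ck1_ne e f h =>
    simp only [map_mul, map_zero, freeLift_of, sectionGen]
    exact hz (of_rel K (.ck1_ne e.1 f.1 fun h' => h (Subtype.ext h')))
  | ck2 v hv =>
    simp only [map_sum, map_mul, freeLift_of, sectionGen]
    have hreg : E.IsRegular v.1 := by
      obtain ⟨e, he⟩ := hv.1
      exact ⟨⟨e.1, congrArg Subtype.val he⟩, hE _⟩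
    have hsub : hv.2.toFinset.image Subtype.val ⊆ hreg.2.toFinset := by
      intro f hf
      obtain ⟨g, hg, rfl⟩ := Finset.mem_image.1 hf
      have hg' : g ∈ (E.quot H hH).emitted v := hv.2.mem_toFinset.1 hg
      exact hreg.2.mem_toFinset.2 (congrArg Subtype.val hg')
    rw [vertex_eq_sum K v.1 hreg, ← Finset.sum_sdiff hsub,
      Finset.sum_image Subtype.val_injective.injOn, add_sub_cancel_right]
    refine sum_mem fun f hf => TwoSidedIdeal.mul_mem_right _ _ _ (edge_mem_ideal K ?_)
    obtain ⟨hf₁, hf₂⟩ := Finset.mem_sdiff.1 hf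
    by_contra hfr
    refine hf₂ (Finset.mem_image.2 ⟨⟨f, hfr⟩, hv.2.mem_toFinset.2 ?_, rfl⟩)
    have hf' : f ∈ E.emitted v.1 := hreg.2.mem_toFinset.1 hf₁
    exact Subtype.ext hf'
  | smul k a b _ ih =>
    rw [map_smul, map_smul, ← smul_sub]
    exact smul_mem_ideal K k ih

theorem section_con (hE : ∀ v, (E.emitted v).Finite) (H : Set E.V) (hH : E.IsHereditary H)
    {a b : FreeAlg K (E.quot H hH)} (h : con K (E.quot H hH) a b) :
    freeLift K (sectionGen K H hH) a - freeLift K (sectionGen K H hH) b ∈ ideal K H := by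
  have h' : RingConGen.Rel (Rel K (E.quot H hH)) a b := h
  clear h
  rw [← TwoSidedIdeal.rel_iff]
  induction h' with
  | of x y h => exact (TwoSidedIdeal.rel_iff _ _ _).2 (sectionGen_rel K hE H hH h)
  | refl x => exact (ideal K H).ringCon.refl _
  | symm _ ih => exact (ideal K H).ringCon.symm ih
  | trans _ _ ih₁ ih₂ => exact (ideal K H).ringCon.trans ih₁ ih₂
  | add _ _ ih₁ ih₂ =>
    rw [map_add (freeLift K _), map_add (freeLift K _)]
    exact (ideal K H).ringCon.add ih₁ ih₂
  | mul _ _ ih₁ ih₂ =>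
    rw [map_mul (freeLift K _), map_mul (freeLift K _)]
    exact (ideal K H).ringCon.mul ih₁ ih₂

theorem quotHom_section (H : Set E.V) (hH : E.IsHerSat H)
    (b : FreeAlg K (E.quot H hH.hereditary)) :
    quotHom K H hH (freeLift K (sectionGen K H hH.hereditary) b) = mk K _ b := by
  let m : FreeAlg K (E.quot H hH.hereditary) →ₙₐ[K] Leavitt K (E.quot H hH.hereditary) :=
    { toFun := mk K _
      map_smul' := mk_smul K
      map_zero' := mk_zero K
      map_add' := mk_add K
      map_mul' := mk_mul K }
  suffices h : (quotHom K H hH).comp (freeLift K (sectionGen K H hH.hereditary)) = m from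
    DFunLike.congr_fun h b
  refine MonoidAlgebra.nonUnitalAlgHom_ext' K (FreeSemigroup.hom_ext (funext fun x => ?_))
  change quotHom K H hH (freeLift K (sectionGen K H hH.hereditary) (FreeAlg.of K x)) =
    mk K _ (FreeAlg.of K x)
  rw [freeLift_of]
  cases x with
  | vertex v => exact (quotHom_mk_of K H hH _).trans (dif_pos v.2)
  | edge e => exact (quotHom_mk_of K H hH _).trans (dif_pos e.2)
  | ghost e => exact (quotHom_mk_of K H hH _).trans (dif_pos e.2)

theorem quotHom_surjective (H : Set E.V) (hH : E.IsHerSat H) :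
    Surjective (quotHom K H hH) := fun y => by
  obtain ⟨b, rfl⟩ := mk_surjective K y
  exact ⟨_, quotHom_section K H hH b⟩

/-- Modulo `I(H)`, every element of `L_K(E)` is a combination of monomials in the generators that
belong to `E/H`. -/
theorem exists_section (H : Set E.V) (hH : E.IsHereditary H) (x : Leavitt K E) :
    ∃ b : FreeAlg K (E.quot H hH), freeLift K (sectionGen K H hH) b - x ∈ ideal K H := by
  simp only [← TwoSidedIdeal.rel_iff]
  induction x using induction_on with
  | of y =>
    have hz : ∀ {x : Leavitt K E}, x ∈ ideal K H → ∃ b : FreeAlg K (E.quot H hH),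
        (ideal K H).ringCon (freeLift K (sectionGen K H hH) b) x := fun hx =>
      ⟨0, by rw [map_zero]; exact (ideal K H).ringCon.symm hx⟩
    have hof : ∀ g : Gen (E.quot H hH), ∃ b : FreeAlg K (E.quot H hH),
        (ideal K H).ringCon (freeLift K (sectionGen K H hH) b) (sectionGen K H hH g) := fun g =>
      ⟨FreeAlg.of K g, by rw [freeLift_of]; exact (ideal K H).ringCon.refl _⟩
    cases y with
    | vertex v =>
      by_cases h : v ∈ H
      · exact hz (vertex_mem_ideal K h)
      · exact hof (.vertex ⟨v, h⟩)
    | edge e =>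
      by_cases h : E.r e ∈ H
      · exact hz (edge_mem_ideal K h)
      · exact hof (.edge ⟨e, h⟩)
    | ghost e =>
      by_cases h : E.r e ∈ H
      · exact hz (ghost_mem_ideal K h)
      · exact hof (.ghost ⟨e, h⟩)
  | zero => exact ⟨0, by rw [map_zero]; exact (ideal K H).ringCon.refl _⟩
  | add x y hx hy =>
    obtain ⟨b, hb⟩ := hx
    obtain ⟨c, hc⟩ := hy
    exact ⟨b + c, by rw [map_add]; exact (ideal K H).ringCon.add hb hc⟩
  | mul x y hx hy =>
    obtain ⟨b, hb⟩ := hx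
    obtain ⟨c, hc⟩ := hy
    exact ⟨b * c, by rw [map_mul]; exact (ideal K H).ringCon.mul hb hc⟩
  | smul k x hx =>
    obtain ⟨b, hb⟩ := hx
    refine ⟨k • b, (TwoSidedIdeal.rel_iff _ _ _).2 ?_⟩
    rw [map_smul, ← smul_sub]
    exact smul_mem_ideal K k ((TwoSidedIdeal.rel_iff _ _ _).1 hb)

theorem quotHom_eq_zero_iff (hE : ∀ v, (E.emitted v).Finite) {H : Set E.V} (hH : E.IsHerSat H)
    {x : Leavitt K E} : quotHom K H hH x = 0 ↔ x ∈ ideal K H := by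
  refine ⟨fun h => ?_, fun h => (TwoSidedIdeal.mem_ker _).1 (ideal_le_ker K H hH h)⟩
  obtain ⟨b, hb⟩ := exists_section K H hH.hereditary x
  have h0 : quotHom K H hH (freeLift K (sectionGen K H hH.hereditary) b - x) = 0 :=
    (TwoSidedIdeal.mem_ker _).1 (ideal_le_ker K H hH hb)
  rw [map_sub, h, sub_zero, quotHom_section, ← mk_zero, mk_eq] at h0
  have h1 := section_con K hE H hH.hereditary h0
  rw [map_zero, sub_zero] at h1
  rw [← sub_sub_cancel (freeLift K (sectionGen K H hH.hereditary) b) x]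
  exact TwoSidedIdeal.sub_mem _ h1 hb

theorem theta_bijective (hE : ∀ v, (E.emitted v).Finite) (H : Set E.V) (hH : E.IsHerSat H) :
    Bijective (theta K H hH) := by
  refine ⟨(injective_iff_map_eq_zero _).2 ?_, fun y => ?_⟩
  · refine Quotient.mk''_surjective.forall.2 fun x hx => ?_
    have hx' : x ∈ ideal K H := (quotHom_eq_zero_iff K hE hH).1 hx
    exact (RingCon.eq _).2 hx'
  · obtain ⟨x, rfl⟩ := quotHom_surjective K H hH y
    exact ⟨(x : QuotRing K (ideal K H)), rfl⟩

/-- The vertices in `I(X)` are those of `X`: any other vertex survives in `L_K(E/X)`. -/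
theorem vertex_mem_ideal_iff (hE : ∀ v, (E.emitted v).Finite) {X : Set E.V} (hX : E.IsHerSat X)
    {v : E.V} : vertex K v ∈ ideal K X ↔ v ∈ X := by
  refine ⟨fun h => ?_, vertex_mem_ideal K⟩
  by_contra hv
  have h0 := (quotHom_eq_zero_iff K hE hX).2 h
  rw [quotHom_vertex_of_notMem K hX hv] at h0
  let E' : RowFiniteGraph.{u} := ⟨E, hE⟩
  exact vertex_ne_zero K (fun w => ((E'.quot X hX.hereditary).rowFinite w).countable) _ h0

theorem ideal_injOn (hE : ∀ v, (E.emitted v).Finite) :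
    Set.InjOn (ideal K) {X : Set E.V | E.IsHerSat X} := fun X hX Y hY h => by
  ext v
  rw [← vertex_mem_ideal_iff K hE hX, h, vertex_mem_ideal_iff K hE hY]

end Leavitt

/-! ### The set `(H₂ * H₁)(E)` -/

namespace DirectedGraph

variable {E : DirectedGraph.{u}}

/-- The set of vertices of `E` lying in `H` or, as vertices of `E/H`, in `G`. -/
def extend (H : Set E.V) (hH : E.IsHereditary H) (G : Set (E.quot H hH).V) : Set E.V :=
  H ∪ Subtype.val '' G

theorem extend_isHerSat {H : Set E.V} (hH : E.IsHerSat H) {G : Set (E.quot H hH.hereditary).V}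
    (hG : (E.quot H hH.hereditary).IsHerSat G) : E.IsHerSat (extend H hH.hereditary G) where
  hereditary := by
    intro v hv x hvx
    induction hvx with
    | refl => exact hv
    | tail _ hab ih =>
      obtain ⟨e, rfl, rfl⟩ := hab
      by_cases her : E.r e ∈ H
      · exact Or.inl her
      · rcases ih with h | ⟨⟨_, h⟩, hg, rfl⟩
        · exact (her (hH.hereditary.range_mem h)).elim
        · exact Or.inr ⟨_, hG.hereditary.range_mem
            (e := (⟨e, her⟩ : (E.quot H hH.hereditary).A)) hg, rfl⟩
  saturated := by
    intro v hreg hv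
    by_cases hvH : v ∈ H
    · exact Or.inl hvH
    refine Or.inr ⟨⟨v, hvH⟩, hG.saturated _ ⟨?_, ?_⟩ ?_, rfl⟩
    · obtain ⟨e, he, her⟩ : ∃ e ∈ E.emitted v, E.r e ∉ H := by
        by_contra! hcon
        exact hvH (hH.saturated v hreg hcon)
      exact ⟨⟨e, her⟩, Subtype.ext he⟩
    · refine Set.Finite.of_finite_image (f := Subtype.val) (hreg.2.subset ?_)
        Subtype.val_injective.injOn
      rintro _ ⟨f, hf, rfl⟩
      exact congrArg Subtype.val hf
    · intro e he
      rcases hv e.1 (congrArg Subtype.val he) with h | ⟨g, hg, hge⟩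
      · exact (e.2 h).elim
      · have : g = (E.quot H hH.hereditary).r e := Subtype.ext hge
        exact this ▸ hg

end DirectedGraph

namespace Leavitt

open DirectedGraph

variable (K : Type w) [Field K] {E : DirectedGraph.{u}}

theorem mem_ideal_extend_iff (hE : ∀ v, (E.emitted v).Finite) {H : Set E.V} (hH : E.IsHerSat H)
    (G : Set (E.quot H hH.hereditary).V) {x : Leavitt K E} :
    x ∈ ideal K (extend H hH.hereditary G) ↔ quotHom K H hH x ∈ ideal K G := by
  have hker : ∀ {y}, quotHom K H hH y = 0 → y ∈ ideal K (extend H hH.hereditary G) := fun h =>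
    TwoSidedIdeal.span_mono (Set.image_mono Set.subset_union_left)
      ((quotHom_eq_zero_iff K hE hH).1 h)
  constructor
  · suffices h : ideal K (extend H hH.hereditary G) ≤
        TwoSidedIdeal.comap (quotHom K H hH) (ideal K G) from
      fun hx => (TwoSidedIdeal.mem_comap _).1 (h hx)
    refine TwoSidedIdeal.span_le.2 ?_
    rintro _ ⟨v, hv, rfl⟩
    refine (TwoSidedIdeal.mem_comap _).2 ?_
    rcases hv with hv | ⟨g, hg, rfl⟩
    · rw [(quotHom_eq_zero_iff K hE hH).2 (vertex_mem_ideal K hv)]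
      exact TwoSidedIdeal.zero_mem _
    · rw [quotHom_vertex_of_notMem K hH g.2]
      exact vertex_mem_ideal K hg
  · suffices h : ∀ y ∈ ideal K G, ∃ x ∈ ideal K (extend H hH.hereditary G),
        quotHom K H hH x = y by
      intro hx
      obtain ⟨x', hx', h⟩ := h _ hx
      rw [← sub_sub_cancel x' x]
      exact TwoSidedIdeal.sub_mem _ hx' (hker (by rw [map_sub, h, sub_self]))
    intro y hy
    have hy' : y ∈ TwoSidedIdeal.span (vertex K '' G) := hy
    clear hy
    induction hy' using TwoSidedIdeal.span_induction with
    | mem y h =>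
      obtain ⟨g, hg, rfl⟩ := h
      exact ⟨_, vertex_mem_ideal K (Or.inr ⟨g, hg, rfl⟩), quotHom_vertex_of_notMem K hH g.2⟩
    | zero => exact ⟨0, TwoSidedIdeal.zero_mem _, map_zero _⟩
    | add y z _ _ ihy ihz =>
      obtain ⟨a, ha, rfl⟩ := ihy
      obtain ⟨b, hb, rfl⟩ := ihz
      exact ⟨a + b, TwoSidedIdeal.add_mem _ ha hb, map_add _ _ _⟩
    | neg y _ ihy =>
      obtain ⟨a, ha, rfl⟩ := ihy
      exact ⟨-a, TwoSidedIdeal.neg_mem _ ha, map_neg _ _⟩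
    | left_absorb a y _ ihy =>
      obtain ⟨b, hb, rfl⟩ := ihy
      obtain ⟨c, rfl⟩ := quotHom_surjective K H hH a
      exact ⟨c * b, TwoSidedIdeal.mul_mem_left _ _ _ hb, map_mul _ _ _⟩
    | right_absorb a y _ ihy =>
      obtain ⟨b, hb, rfl⟩ := ihy
      obtain ⟨c, rfl⟩ := quotHom_surjective K H hH a
      exact ⟨b * c, TwoSidedIdeal.mul_mem_right _ _ _ hb, map_mul _ _ _⟩

theorem theta_image_imageInQuot (H : Set E.V) (hH : E.IsHerSat H)
    (I : TwoSidedIdeal (Leavitt K E)) :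
    theta K H hH '' imageInQuot K (ideal K H) I = quotHom K H hH '' {x | x ∈ I} :=
  Set.image_image _ _ _

end Leavitt

namespace PointFunctor

open DirectedGraph Leavitt

/-- The set `(H₂ * H₁)(E)`. -/
def mixedVerts (H₂ H₁ : PointFunctor.{u}) (h₁ : H₁.IsHerSat) (E : RowFiniteGraph.{u}) : Set E.V :=
  extend (H₁.verts E) (h₁ E).hereditary (H₂.verts (E.quot (H₁.verts E) (h₁ E).hereditary))

variable (K : Type w) [Field K] {H₂ H₁ : PointFunctor.{u}}

theorem mixedVerts_isMixedSet (h₂ : H₂.IsHerSat) (h₁ : H₁.IsHerSat) (E : RowFiniteGraph.{u}) :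
    IsMixedSet K H₂ H₁ h₁ E (mixedVerts H₂ H₁ h₁ E) where
  isHerSat := extend_isHerSat (h₁ E) (h₂ (E.quot (H₁.verts E) (h₁ E).hereditary))
  le := TwoSidedIdeal.span_mono (Set.image_mono Set.subset_union_left)
  theta_image := by
    rw [theta_image_imageInQuot]
    ext y
    constructor
    · rintro ⟨x, hx, rfl⟩
      exact (mem_ideal_extend_iff K E.rowFinite (h₁ E) _).1 hx
    · intro hy
      obtain ⟨x, rfl⟩ := quotHom_surjective K _ (h₁ E) y
      exact ⟨x, (mem_ideal_extend_iff K E.rowFinite (h₁ E) _).2 hy, rfl⟩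

/-- A mixed set `X` is determined by the ideal `I(X)`, which in turn is the preimage of
`I(H₂(E/H₁(E)))`. -/
theorem _root_.LPA.IsMixedSet.unique {h₁ : H₁.IsHerSat} {E : RowFiniteGraph.{u}} {X Y : Set E.V}
    (hX : IsMixedSet K H₂ H₁ h₁ E X) (hY : IsMixedSet K H₂ H₁ h₁ E Y) : X = Y := by
  have key : ∀ {X Y : Set E.V}, IsMixedSet K H₂ H₁ h₁ E X → IsMixedSet K H₂ H₁ h₁ E Y →
      ideal K X ≤ ideal K Y := by
    intro X Y hX hY x hx
    have himg := hX.theta_image.trans hY.theta_image.symm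
    rw [theta_image_imageInQuot, theta_image_imageInQuot] at himg
    obtain ⟨y, hy, hyx⟩ := himg.subset (Set.mem_image_of_mem _ hx)
    rw [← sub_sub_cancel y x]
    refine TwoSidedIdeal.sub_mem _ hy (hY.le ((quotHom_eq_zero_iff K E.rowFinite (h₁ E)).1 ?_))
    rw [map_sub, hyx, sub_self]
  exact ideal_injOn K E.rowFinite hX.isHerSat hY.isHerSat (le_antisymm (key hX hY) (key hY hX))

/-! ### The point functor `H₂ * H₁` -/

theorem onV_mem (H : PointFunctor.{u}) {E F : RowFiniteGraph.{u}} (α : E ⟶ F) {v : E.V}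
    (hv : v ∈ H.verts E) : GraphIso.onV α v ∈ H.verts F :=
  H.map α hv

theorem onV_mem_iff (H : PointFunctor.{u}) {E F : RowFiniteGraph.{u}} (α : E ⟶ F) {v : E.V} :
    GraphIso.onV α v ∈ H.verts F ↔ v ∈ H.verts E := by
  refine ⟨fun h => ?_, H.onV_mem α⟩
  let β : F ⟶ E :=
    { onV := (GraphIso.onV α).symm
      onA := (GraphIso.onA α).symm
      source_comm := fun e => by
        rw [Equiv.eq_symm_apply, ← GraphIso.source_comm α, Equiv.apply_symm_apply]
      range_comm := fun e => by
        rw [Equiv.eq_symm_apply, ← GraphIso.range_comm α, Equiv.apply_symm_apply] }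
  have := H.onV_mem β h
  rwa [show GraphIso.onV β (GraphIso.onV α v) = v from Equiv.symm_apply_apply _ v] at this

/-- The isomorphism `E/H(E) → F/H(F)` induced by a graph isomorphism `E → F`. -/
def quotMap (H : PointFunctor.{u}) (h : H.IsHerSat) {E F : RowFiniteGraph.{u}} (α : E ⟶ F) :
    E.quot (H.verts E) (h E).hereditary ⟶ F.quot (H.verts F) (h F).hereditary where
  onV := (GraphIso.onV α).subtypeEquiv fun _ => not_congr (H.onV_mem_iff α).symm
  onA := (GraphIso.onA α).subtypeEquiv fun e => by
    rw [GraphIso.range_comm α, H.onV_mem_iff α]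
  source_comm e := Subtype.ext (GraphIso.source_comm α e.1)
  range_comm e := Subtype.ext (GraphIso.range_comm α e.1)

/-- The point functor `H₂ * H₁`. -/
def mixed (H₂ H₁ : PointFunctor.{u}) (h₁ : H₁.IsHerSat) : PointFunctor.{u} where
  obj E := mixedVerts H₂ H₁ h₁ E
  map {E F} α := by
    rintro v (hv | ⟨g, hg, rfl⟩)
    · exact Or.inl (H₁.onV_mem α hv)
    · exact Or.inr ⟨_, H₂.onV_mem (H₁.quotMap h₁ α) hg, rfl⟩

/-- If `q_E : L_K(E) → L_K(E/H₁(E))` and `q_F` are the canonical homomorphisms, a ring isomorphism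
`f : L_K(E) → L_K(F)` preserving the ideals `I(H₁)` induces an isomorphism `g` with
`g ∘ q_E = q_F ∘ f`. It preserves the ideals `I(H₂)`, whose preimages are the ideals
`I(H₂ * H₁)`. -/
theorem mixed_isInvariant {h₁ : H₁.IsHerSat}
    (i₁ : H₁.IsInvariant K) (i₂ : H₂.IsInvariant K) : (mixed H₂ H₁ h₁).IsInvariant K := by
  intro E F f
  let qE := quotHom K (H₁.verts E) (h₁ E)
  let qF := quotHom K (H₁.verts F) (h₁ F)
  have hqE : Surjective qE := quotHom_surjective K _ (h₁ E)
  have hqF : Surjective qF := quotHom_surjective K _ (h₁ F)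
  have hker : ∀ x, qF (f x) = 0 ↔ qE x = 0 := by
    intro x
    rw [quotHom_eq_zero_iff K F.rowFinite (h₁ F), quotHom_eq_zero_iff K E.rowFinite (h₁ E)]
    change f x ∈ {y | y ∈ ideal K (H₁.verts F)} ↔ _
    rw [← i₁ E F f, f.injective.mem_set_image]
    rfl
  have heq : ∀ x y, qF (f x) = qF (f y) ↔ qE x = qE y := by
    intro x y
    rw [← sub_eq_zero, ← map_sub, ← map_sub, hker, map_sub, sub_eq_zero]
  let g₀ := fun y => qF (f (surjInv hqE y))
  have hg₀ : ∀ x, g₀ (qE x) = qF (f x) := fun x => (heq _ _).2 (surjInv_eq hqE _)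
  let g : Leavitt K (E.quot (H₁.verts E) (h₁ E).hereditary).toDirectedGraph ≃+*
      Leavitt K (F.quot (H₁.verts F) (h₁ F).hereditary).toDirectedGraph :=
    { Equiv.ofBijective g₀ (by
        refine ⟨hqE.forall₂.2 fun x y h => ?_, hqF.forall.2 fun y => ⟨qE (f.symm y), ?_⟩⟩
        · rwa [hg₀, hg₀, heq] at h
        · rw [hg₀, f.apply_symm_apply]) with
      map_add' := hqE.forall₂.2 fun x y => by
        change g₀ (qE x + qE y) = g₀ (qE x) + g₀ (qE y)
        rw [← map_add, hg₀, hg₀, hg₀, map_add, map_add]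
      map_mul' := hqE.forall₂.2 fun x y => by
        change g₀ (qE x * qE y) = g₀ (qE x) * g₀ (qE y)
        rw [← map_mul, hg₀, hg₀, hg₀, map_mul, map_mul] }
  have hg : ∀ x, g (qE x) = qF (f x) := hg₀
  have hmem : ∀ x, f x ∈ ideal K ((mixed H₂ H₁ h₁).verts F) ↔
      x ∈ ideal K ((mixed H₂ H₁ h₁).verts E) := by
    intro x
    refine (mem_ideal_extend_iff K F.rowFinite (h₁ F) _).trans
      (Iff.trans ?_ (mem_ideal_extend_iff K E.rowFinite (h₁ E) _).symm)
    change qF (f x) ∈ {y | y ∈ ideal K (H₂.verts (F.quot (H₁.verts F) (h₁ F).hereditary))} ↔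
      qE x ∈ _
    rw [← hg, ← i₂ _ _ g, g.injective.mem_set_image]
    rfl
  ext y
  constructor
  · rintro ⟨x, hx, rfl⟩
    exact (hmem x).2 hx
  · intro hy
    refine ⟨f.symm y, (hmem _).1 ?_, f.apply_symm_apply y⟩
    rwa [f.apply_symm_apply]

end PointFunctor

end LPA

theorem mainTheorem8 (K : Type w) [Field K] (H₁ H₂ : LPA.PointFunctor.{u})
    (h₁ : H₁.IsHerSat) (h₂ : H₂.IsHerSat) :
    -- `θ : L_K(E)/I(H₁(E)) → L_K(E/H₁(E))` is an isomorphism for every graph `E`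
    (∀ E : LPA.RowFiniteGraph.{u},
      Function.Bijective (LPA.Leavitt.theta K (H₁.verts E) (h₁ E))) ∧
    -- the set `(H₂ * H₁)(E)` exists and is unique for every graph `E`
    (∀ E : LPA.RowFiniteGraph.{u}, ∃! X : Set E.V, LPA.IsMixedSet K H₂ H₁ h₁ E X) ∧
    -- these sets form a point functor `H₂ * H₁`, hereditary and saturated, and it is invariant
    -- whenever `H₁` and `H₂` are
    ∃ H : LPA.PointFunctor.{u}, LPA.PointFunctor.IsMixed K H₂ H₁ h₁ H ∧ H.IsHerSat ∧
      (LPA.PointFunctor.IsInvariant K H₁ → LPA.PointFunctor.IsInvariant K H₂ →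
        LPA.PointFunctor.IsInvariant K H) :=
  ⟨fun E => LPA.Leavitt.theta_bijective K E.rowFinite _ (h₁ E),
    fun E => ⟨_, LPA.PointFunctor.mixedVerts_isMixedSet K h₂ h₁ E,
      fun _ hX => hX.unique K (LPA.PointFunctor.mixedVerts_isMixedSet K h₂ h₁ E)⟩,
    LPA.PointFunctor.mixed H₂ H₁ h₁, LPA.PointFunctor.mixedVerts_isMixedSet K h₂ h₁,
    fun E => (LPA.PointFunctor.mixedVerts_isMixedSet K h₂ h₁ E).isHerSat,
    LPA.PointFunctor.mixed_isInvariant K⟩
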